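/- Let $\varepsilon\in\{0,\tfrac12\}$ and let $\mathcal{SV}(\varepsilon)$ be the Schrödinger–Virasoro Lie algebra, i.e. the complex Lie algebra with basis $\{L_i, Y_j, M_i : i\in\mathbb{Z},\ j\in\varepsilon+\mathbb{Z}\}$ and brackets $$[L_m,L_n]=(m-n)L_{m+n},\quad [L_m,Y_n]=(\tfrac12 m-n)Y_{m+n},\quad [L_m,M_n]=-nM_{m+n},$$ $$[Y_m,Y_n]=(m-n)M_{m+n},\quad [Y_m,M_n]=[M_m,M_n]=0,$$ where the indices of the $L$'s and $M$'s run over $\mathbb{Z}$ and those of the $Y$'s over $\varepsilon+\mathbb{Z}$. Let $f:\mathcal{SV}(\varepsilon)\times\mathcal{SV}(\varepsilon)\to\mathcal{SV}(\varepsilon)$ be a biderivation, i.e. a $\mathbb{C}$-bilinear map with $$f([x,y],z)=[x,f(y,z)]+[f(x,z),y],\qquad f(x,[y,z])=[f(x,y),z]+[y,f(x,z)]$$ for all $x,y,z\in\mathcal{SV}(\varepsilon)$. If $f$ is skew-symmetric, i.e. $f(x,y)=-f(y,x)$ for all $x,y$, then $f$ is inner: there is $\lambda\in\mathbb{C}$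 such that $f(x,y)=\lambda[x,y]$ for all $x,y\in\mathcal{SV}(\varepsilon)$. -/

import Mathlib

namespace SchrodingerVirasoro

/-- The two admissible values of the parameter `ε`, namely `0` and `1/2`. -/
inductive Eps : Type
  | zero : Eps
  | half : Eps

/-- The value of `ε` as a complex number. -/
noncomputable def Eps.val : Eps → ℂ
  | Eps.zero => 0
  | Eps.half => 1 / 2

/-- The integer `2 ε`. -/
def Eps.twice : Eps → ℤ
  | Eps.zero => 0
  | Eps.half => 1

theorem Eps.twice_cast (ε : Eps) : (ε.twice : ℂ) = 2 * ε.val := by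
  cases ε <;> simp [Eps.twice, Eps.val]

/-- Labels of the basis of `SV(ε)`: for `i k : ℤ`, the labels `L i` and `M i` stand for the
basis vectors `L_i` and `M_i`, and `Y k` stands for `Y_{ε + k}`. As `k` runs through `ℤ`, the
index `ε + k` runs exactly once through `ε + ℤ`. -/
inductive Label : Type
  | L : ℤ → Label
  | Y : ℤ → Label
  | M : ℤ → Label

end SchrodingerVirasoro

open SchrodingerVirasoro in
/-- The underlying vector space of the Schrödinger–Virasoro Lie algebra `SV(ε)`: the complex
vector space of finite formal linear combinations of the `L_i`, `Y_j`, `M_i`, with `i ∈ ℤ` and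
`j ∈ ε + ℤ`. -/
def SV (_ε : Eps) : Type := Label →₀ ℂ

namespace SchrodingerVirasoro

noncomputable instance (ε : Eps) : AddCommGroup (SV ε) :=
  inferInstanceAs (AddCommGroup (Label →₀ ℂ))

noncomputable instance (ε : Eps) : Module ℂ (SV ε) :=
  inferInstanceAs (Module ℂ (Label →₀ ℂ))

/-- The defining basis of `SV(ε)`. -/
noncomputable def basis (ε : Eps) : Module.Basis Label ℂ (SV ε) :=
  Module.Basis.ofRepr (LinearEquiv.refl ℂ (Label →₀ ℂ))

/-- The basis vector `L_i`. -/
noncomputable def vL (ε : Eps) (i : ℤ) : SV ε := basis ε (Label.L i)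

/-- The basis vector `Y_{ε + k}`. -/
noncomputable def vY (ε : Eps) (k : ℤ) : SV ε := basis ε (Label.Y k)

/-- The basis vector `M_i`. -/
noncomputable def vM (ε : Eps) (i : ℤ) : SV ε := basis ε (Label.M i)

/-- The bracket of two basis vectors: writing `ε + n` for the index of the vector labelled `Y n`,
`[L_m, L_n] = (m - n) L_{m+n}`, `[L_m, Y_j] = (m/2 - j) Y_{m+j}`, `[L_m, M_n] = -n M_{m+n}`,
`[Y_i, Y_j] = (i - j) M_{i+j}`, `[Y_i, M_n] = [M_m, M_n] = 0`, and the skew-symmetric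
counterparts. -/
noncomputable def basisBracket (ε : Eps) : Label → Label → SV ε
  | Label.L m, Label.L n => ((m : ℂ) - n) • vL ε (m + n)
  | Label.L m, Label.Y n => ((1 / 2 : ℂ) * m - (ε.val + n)) • vY ε (m + n)
  | Label.L m, Label.M n => (-(n : ℂ)) • vM ε (m + n)
  | Label.Y m, Label.L n => -(((1 / 2 : ℂ) * n - (ε.val + m)) • vY ε (n + m))
  | Label.Y m, Label.Y n => ((ε.val + m) - (ε.val + n)) • vM ε (ε.twice + m + n)
  | Label.Y _, Label.M _ => 0
  | Label.M m, Label.L n => -((-(m : ℂ)) • vM ε (n + m))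
  | Label.M _, Label.Y _ => 0
  | Label.M _, Label.M _ => 0

/-- The bilinear extension of the bracket of basis vectors. -/
noncomputable def bracketHom (ε : Eps) : SV ε →ₗ[ℂ] SV ε →ₗ[ℂ] SV ε :=
  (basis ε).constr ℂ fun a => (basis ε).constr ℂ fun b => basisBracket ε a b

theorem bracketHom_basis (ε : Eps) (a b : Label) :
    bracketHom ε (basis ε a) (basis ε b) = basisBracket ε a b := by
  simp [bracketHom]

theorem basisBracket_skew (ε : Eps) (a b : Label) :
    basisBracket ε a b = -basisBracket ε b a := by
  rcases a with m | m | m <;> rcases b with n | n | n <;> simp only [basisBracket, neg_neg, neg_zero]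
  · rw [add_comm m n, ← neg_smul]; congr 1; ring
  · rw [add_right_comm, ← neg_smul]; congr 1; ring

theorem bracketHom_skew (ε : Eps) (x y : SV ε) : bracketHom ε x y = -bracketHom ε y x := by
  have h : bracketHom ε = -(bracketHom ε).flip := by
    refine (basis ε).ext fun a => (basis ε).ext fun b => ?_
    simp only [LinearMap.neg_apply, LinearMap.flip_apply, bracketHom_basis]
    exact basisBracket_skew ε a b
  exact LinearMap.congr_fun₂ h x y

theorem bracketHom_jacobi_basis (ε : Eps) (a b c : Label) :
    bracketHom ε (basis ε a) (basisBracket ε b c) =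
      bracketHom ε (basisBracket ε a b) (basis ε c) +
        bracketHom ε (basis ε b) (basisBracket ε a c) := by
  have ht := ε.twice_cast
  rcases a with m | m | m <;> rcases b with n | n | n <;> rcases c with p | p | p <;>
    simp only [basisBracket, vL, vY, vM, map_smul, map_neg, map_zero, LinearMap.smul_apply,
      LinearMap.neg_apply, LinearMap.zero_apply, bracketHom_basis, smul_zero, neg_zero, add_zero,
      smul_neg, neg_neg, Int.cast_add, ht] <;>
    simp only [add_assoc, add_comm, add_left_comm] <;>
    module

theorem bracketHom_jacobi (ε : Eps) (x y z : SV ε) :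
    bracketHom ε x (bracketHom ε y z) =
      bracketHom ε (bracketHom ε x y) z + bracketHom ε y (bracketHom ε x z) := by
  let B := bracketHom ε
  let C : (SV ε →ₗ[ℂ] SV ε) →ₗ[ℂ] (SV ε →ₗ[ℂ] SV ε) →ₗ[ℂ] (SV ε →ₗ[ℂ] SV ε) :=
    LinearMap.llcomp ℂ (SV ε) (SV ε) (SV ε)
  let F : SV ε →ₗ[ℂ] SV ε →ₗ[ℂ] SV ε →ₗ[ℂ] SV ε := (C.compl₂ B).comp B
  have h : F = B.compr₂ B + F.flip := by
    refine (basis ε).ext fun a => (basis ε).ext fun b => (basis ε).ext fun c => ?_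
    simpa [F, C, B, bracketHom_basis] using bracketHom_jacobi_basis ε a b c
  simpa [F, C, B] using LinearMap.congr_fun (LinearMap.congr_fun₂ h x y) z

theorem eq_zero_of_eq_neg (ε : Eps) (x : SV ε) (h : x = -x) : x = 0 := by
  have h2 : (2 : ℂ) • x = 0 := by rw [two_smul]; nth_rewrite 1 [h]; exact neg_add_cancel x
  exact (smul_eq_zero.mp h2).resolve_left two_ne_zero

noncomputable instance (ε : Eps) : LieRing (SV ε) where
  bracket x y := bracketHom ε x y
  add_lie x y z := by simp
  lie_add x y z := by simp
  lie_self x := eq_zero_of_eq_neg ε _ (bracketHom_skew ε x x)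
  leibniz_lie x y z := bracketHom_jacobi ε x y z

noncomputable instance (ε : Eps) : LieAlgebra ℂ (SV ε) where
  toModule := inferInstance
  lie_smul t x y := (bracketHom ε x).map_smul t y

end SchrodingerVirasoro

section Biderivation

variable {R L : Type*} [CommRing R] [LieRing L] [LieAlgebra R L]

/-- A bilinear map `f : L × L → L` (in curried form) on a Lie algebra is a biderivation if it is
a derivation in each of its two arguments. -/
structure IsBiderivation (f : L →ₗ[R] L →ₗ[R] L) : Prop where
  lie_left : ∀ x y z : L, f ⁅x, y⁆ z = ⁅x, f y z⁆ + ⁅f x z, y⁆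
  lie_right : ∀ x y z : L, f x ⁅y, z⁆ = ⁅f x y, z⁆ + ⁅y, f x z⁆

/-- A bilinear map `f : L × L → L` is skew-symmetric if `f(x, y) = -f(y, x)`. -/
def IsSkewSymmetricMap (f : L →ₗ[R] L →ₗ[R] L) : Prop :=
  ∀ x y : L, f x y = -f y x

/-- A bilinear map `f : L × L → L` is inner if `f(x, y) = c [x, y]` for some scalar `c`. -/
def IsInnerBiderivation (f : L →ₗ[R] L →ₗ[R] L) : Prop :=
  ∃ c : R, ∀ x y : L, f x y = c • ⁅x, y⁆

end Biderivation

/-! ### Identities for biderivations of a general Lie algebra. -/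

section Biderivation

variable {R L : Type*} [CommRing R] [LieRing L] [LieAlgebra R L] {f : L →ₗ[R] L →ₗ[R] L}

/-! A skew-symmetric biderivation satisfies [f(x,y),[u,v]] = [[x,y],f(u,v)]
(`IsBiderivation.lie_apply_lie`). Applied to the pairs (L_0,L_1) and (L_0,L_2), this forces
f(L_0,L_1) and f(L_0,L_2) to be cL_1 and 2cL_2 modulo central elements, with one common c
(`exists_smul_vL`). Put g(x,y) = f(x,y) + c[x,y]. Then g(L_0,L_1) and g(L_0,L_2) are central, so the
same identity makes every g(x,y) commute with L_1 and L_2; such elements are central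
(`lie_eq_zero_of_vL_lie_eq_zero`). A biderivation with central values kills brackets, and the
algebra is perfect, so g = 0 (`eq_zero_of_lie_apply_eq_zero`). -/

/-- Expand f([x,u],[y,v]) in the first argument then the second, and in the opposite order; the
Jacobi identity rearranges the difference. -/
theorem IsBiderivation.exchange (hf : IsBiderivation f) (x y u v : L) :
    ⁅f x y, ⁅u, v⁆⁆ - ⁅⁅x, y⁆, f u v⁆ = ⁅f u y, ⁅x, v⁆⁆ - ⁅⁅u, y⁆, f x v⁆ := by
  have h1 : f ⁅x, u⁆ ⁅y, v⁆ =
      ⁅x, ⁅f u y, v⁆ + ⁅y, f u v⁆⁆ + ⁅⁅f x y, v⁆ + ⁅y, f x v⁆, u⁆ := by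
    rw [hf.lie_left, hf.lie_right, hf.lie_right]
  have h2 : f ⁅x, u⁆ ⁅y, v⁆ =
      ⁅⁅x, f u y⁆ + ⁅f x y, u⁆, v⁆ + ⁅y, ⁅x, f u v⁆ + ⁅f x v, u⁆⁆ := by
    rw [hf.lie_right, hf.lie_left, hf.lie_left]
  have h := h1.symm.trans h2
  simp only [lie_add, add_lie] at h
  have e1 := leibniz_lie x (f u y) v
  have e2 := leibniz_lie x y (f u v)
  have e3 := leibniz_lie (f x y) u v
  have e5 := leibniz_lie y u (f x v)
  have s : ⁅y, ⁅f x v, u⁆⁆ = -⁅y, ⁅u, f x v⁆⁆ := by rw [← lie_neg, lie_skew]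
  rw [e1, e2, s, e5, ← lie_skew ⁅f x y, v⁆ u, ← lie_skew ⁅y, f x v⁆ u] at h
  rw [e3, ← lie_skew u y, neg_lie]
  linear_combination (norm := module) -h

/-- For a skew-symmetric biderivation, the bracket may be moved across `f`. -/
theorem IsBiderivation.lie_apply_lie [Invertible (2 : R)] (hf : IsBiderivation f)
    (hskew : IsSkewSymmetricMap f) (x y u v : L) :
    ⁅f x y, ⁅u, v⁆⁆ = ⁅⁅x, y⁆, f u v⁆ := by
  let φ : L → L → L → L → L := fun x y u v => ⁅f x y, ⁅u, v⁆⁆ - ⁅⁅x, y⁆, f u v⁆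
  have h13 (x y u v) : φ x y u v = φ u y x v := hf.exchange x y u v
  have h12 (x y u v) : φ x y u v = -φ y x u v := by
    simp only [φ]
    rw [hskew x y, ← lie_skew x y]
    simp only [neg_lie]
    abel
  -- Swapping slots 1 and 2 changes the sign of φ while swapping slots 1 and 3 preserves it. These
  -- transpositions are conjugate in S_3, so φ = -φ.
  have h : φ x y u v = -φ x y u v :=
    calc φ x y u v = -φ y x u v := h12 ..
      _ = -φ u x y v := by rw [h13 y]
      _ = φ x u y v := by rw [h12 u, neg_neg]
      _ = φ y u x v := h13 ..
      _ = -φ u y x v := h12 ..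
      _ = -φ x y u v := by rw [h13 u]
  have h2 : (2 : R) • φ x y u v = 0 := by
    rw [two_smul]
    nth_rewrite 1 [h]
    exact neg_add_cancel _
  have h3 : φ x y u v = 0 := by
    rw [← invOf_smul_smul (2 : R) (φ x y u v), h2, smul_zero]
  exact sub_eq_zero.mp h3

theorem IsBiderivation.sub_smul_bracket (hf : IsBiderivation f) (c : R) :
    IsBiderivation (f - c • (LieModule.toEnd R L L : L →ₗ[R] L →ₗ[R] L)) where
  lie_left x y z := by
    simp only [LinearMap.sub_apply, LinearMap.smul_apply, LieHom.coe_toLinearMap,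
      LieModule.toEnd_apply_apply, hf.lie_left, lie_sub, sub_lie, lie_smul, smul_lie]
    rw [lie_lie x y z, ← lie_skew y ⁅x, z⁆]
    module
  lie_right x y z := by
    simp only [LinearMap.sub_apply, LinearMap.smul_apply, LieHom.coe_toLinearMap,
      LieModule.toEnd_apply_apply, hf.lie_right, lie_sub, sub_lie, lie_smul, smul_lie]
    rw [leibniz_lie x y z]
    module

theorem IsSkewSymmetricMap.sub_smul_bracket (hskew : IsSkewSymmetricMap f) (c : R) :
    IsSkewSymmetricMap (f - c • (LieModule.toEnd R L L : L →ₗ[R] L →ₗ[R] L)) := by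
  intro x y
  simp only [LinearMap.sub_apply, LinearMap.smul_apply, LieHom.coe_toLinearMap,
    LieModule.toEnd_apply_apply]
  rw [hskew x y, ← lie_skew x y]
  module

end Biderivation

/-! ### The action of ad L_m, central elements and perfectness of SV(ε). -/

namespace SchrodingerVirasoro

theorem lie_basis (ε : Eps) (a b : Label) : ⁅basis ε a, basis ε b⁆ = basisBracket ε a b :=
  bracketHom_basis ε a b

/-- The coefficient by which `ad L_m` acts on a basis vector. -/
noncomputable def adCoeff (ε : Eps) (m : ℤ) : Label → ℂ
  | Label.L n => m - n
  | Label.Y n => 1 / 2 * m - (ε.val + n)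
  | Label.M n => -n

/-- Translation of the index of a label. -/
def Label.shift (m : ℤ) : Label → Label
  | Label.L n => Label.L (m + n)
  | Label.Y n => Label.Y (m + n)
  | Label.M n => Label.M (m + n)

theorem Label.shift_injective (m : ℤ) : Function.Injective (Label.shift m) := by
  rintro (a | a | a) (b | b | b) h <;> simp_all [Label.shift]

theorem vL_lie_basis (ε : Eps) (m : ℤ) (a : Label) :
    ⁅vL ε m, basis ε a⁆ = adCoeff ε m a • basis ε (a.shift m) := by
  rw [vL, lie_basis]
  cases a <;> rfl

/-- Because ad L_m is a weighted injective shift of the basis, equations in it can be read off one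
coefficient at a time. -/
theorem repr_vL_lie (ε : Eps) (m : ℤ) (x : SV ε) (a : Label) :
    (basis ε).repr ⁅vL ε m, x⁆ (a.shift m) = adCoeff ε m a * (basis ε).repr x a := by
  have h : (basis ε).coord (a.shift m) ∘ₗ bracketHom ε (vL ε m) =
      adCoeff ε m a • (basis ε).coord a := by
    refine (basis ε).ext fun b => ?_
    have := vL_lie_basis ε m b
    change bracketHom ε (vL ε m) (basis ε b) = _ at this
    simp only [LinearMap.comp_apply, this, map_smul, LinearMap.smul_apply,
      Module.Basis.coord_apply, Module.Basis.repr_self, smul_eq_mul]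
    by_cases hb : b = a
    · subst hb; simp
    · rw [Finsupp.single_eq_of_ne' ((Label.shift_injective m).ne hb),
        Finsupp.single_eq_of_ne' hb]
      simp
  exact LinearMap.congr_fun h x

theorem repr_eq_zero_of_vL_lie_eq_zero {ε : Eps} {m : ℤ} {x : SV ε} (h : ⁅vL ε m, x⁆ = 0)
    {a : Label} (ha : adCoeff ε m a ≠ 0) : (basis ε).repr x a = 0 := by
  have := repr_vL_lie ε m x a
  rw [h] at this
  simpa [ha] using this.symm

theorem vM_zero_lie (ε : Eps) (y : SV ε) : ⁅vM ε 0, y⁆ = 0 := by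
  have h : bracketHom ε (vM ε 0) = 0 := by
    refine (basis ε).ext fun b => ?_
    rw [vM, bracketHom_basis]
    cases b <;> simp [basisBracket]
  exact LinearMap.congr_fun h y

theorem lie_eq_zero_of_repr {ε : Eps} {x : SV ε}
    (h : ∀ a, a ≠ Label.M 0 → (basis ε).repr x a = 0) (y : SV ε) : ⁅x, y⁆ = 0 := by
  have hx : x = (basis ε).repr x (Label.M 0) • vM ε 0 := by
    refine (basis ε).ext_elem fun a => ?_
    by_cases ha : a = Label.M 0
    · subst ha; simp [vM]
    · rw [h a ha]
      simp [vM, Finsupp.single_eq_of_ne ha]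
  rw [hx, smul_lie, vM_zero_lie, smul_zero]

theorem adCoeff_one_Y_ne_zero_or (ε : Eps) (n : ℤ) :
    adCoeff ε 1 (Label.Y n) ≠ 0 ∨ adCoeff ε 2 (Label.Y n) ≠ 0 := by
  by_contra! h
  simp only [adCoeff] at h
  have := h.1.trans h.2.symm
  norm_num at this

theorem adCoeff_M_ne_zero (ε : Eps) (m : ℤ) {n : ℤ} (h : n ≠ 0) :
    adCoeff ε m (Label.M n) ≠ 0 := by
  simpa [adCoeff] using h

theorem adCoeff_L_ne_zero (ε : Eps) {m n : ℤ} (h : m ≠ n) :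
    adCoeff ε m (Label.L n) ≠ 0 := by
  simpa [adCoeff, sub_eq_zero] using h

/-- The only basis vectors killed by ad L_m are L_m, M_0 and, when m/2 lies in ε + ℤ, Y_{m/2}. For m
= 1 and m = 2 the only common one is the central M_0. -/
theorem lie_eq_zero_of_vL_lie_eq_zero {ε : Eps} {x : SV ε} (h1 : ⁅vL ε 1, x⁆ = 0)
    (h2 : ⁅vL ε 2, x⁆ = 0) (y : SV ε) : ⁅x, y⁆ = 0 := by
  refine lie_eq_zero_of_repr (fun a ha => ?_) y
  rcases a with n | n | n
  · by_cases hn : (1 : ℤ) = n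
    · exact repr_eq_zero_of_vL_lie_eq_zero h2 (adCoeff_L_ne_zero ε (by omega))
    · exact repr_eq_zero_of_vL_lie_eq_zero h1 (adCoeff_L_ne_zero ε hn)
  · rcases adCoeff_one_Y_ne_zero_or ε n with hn | hn
    · exact repr_eq_zero_of_vL_lie_eq_zero h1 hn
    · exact repr_eq_zero_of_vL_lie_eq_zero h2 hn
  · exact repr_eq_zero_of_vL_lie_eq_zero h1 (adCoeff_M_ne_zero ε 1 fun hn => ha (by rw [hn]))

/-- If `A` commutes with `L_1`, `B` with `L_2`, and they are linked by `2[A, L_2] = [L_1, B]`,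
then up to the centre `A` and `B` are proportional to `L_1` and `2 L_2`, by the same scalar. -/
theorem exists_smul_vL {ε : Eps} {A B : SV ε} (hA : ⁅vL ε 1, A⁆ = 0)
    (hB : ⁅vL ε 2, B⁆ = 0) (hAB : (2 : ℂ) • ⁅vL ε 2, A⁆ + ⁅vL ε 1, B⁆ = 0) :
    ∃ c : ℂ, (∀ y : SV ε, ⁅A - c • vL ε 1, y⁆ = 0) ∧ ∀ y : SV ε, ⁅B - (2 * c) • vL ε 2, y⁆ = 0 := by
  have key (a b : Label) (hab : a.shift 2 = b.shift 1) :
      2 * (adCoeff ε 2 a * (basis ε).repr A a) + adCoeff ε 1 b * (basis ε).repr B b = 0 := by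
    rw [← repr_vL_lie, ← repr_vL_lie, ← hab]
    have := congrArg (fun x => (basis ε).repr x (a.shift 2)) hAB
    simpa using this
  have hL := key (Label.L 1) (Label.L 2) rfl
  have hY (n : ℤ) := key (Label.Y n) (Label.Y (n + 1)) (by simp [Label.shift]; ring)
  have hself (m : ℤ) : ⁅vL ε m, vL ε m⁆ = 0 := lie_self _
  refine ⟨(basis ε).repr A (Label.L 1), lie_eq_zero_of_repr fun a ha => ?_,
    lie_eq_zero_of_repr fun a ha => ?_⟩
  · rcases a with n | n | n
    · by_cases hn : (1 : ℤ) = n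
      · subst hn; simp [vL]
      · exact repr_eq_zero_of_vL_lie_eq_zero (by rw [lie_sub, lie_smul, hA, hself]; simp)
          (adCoeff_L_ne_zero ε hn)
    -- Only Y_{1/2} can survive in A. The link compares it with the Y_{3/2} coefficient of B, which
    -- vanishes since ad L_2 kills only Y_1 among the Y's.
    · have hA0 : (basis ε).repr A (Label.Y n) = 0 := by
        by_cases hn : adCoeff ε 1 (Label.Y n) = 0
        · have hB0 : (basis ε).repr B (Label.Y (n + 1)) = 0 := by
            refine repr_eq_zero_of_vL_lie_eq_zero hB fun h => ?_
            simp only [adCoeff] at hn h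
            push_cast at hn h
            exact absurd (show (1 : ℂ) = 0 by linear_combination 2 * hn - 2 * h) one_ne_zero
          have hn2 : adCoeff ε 2 (Label.Y n) ≠ 0 :=
            (adCoeff_one_Y_ne_zero_or ε n).resolve_left (not_not.mpr hn)
          simpa [hB0, hn2] using hY n
        · exact repr_eq_zero_of_vL_lie_eq_zero hA hn
      simp [vL, hA0]
    · exact repr_eq_zero_of_vL_lie_eq_zero (m := 1) (by rw [lie_sub, lie_smul, hA, hself]; simp)
        (adCoeff_M_ne_zero ε 1 fun hn => ha (by rw [hn]))
  · rcases a with n | n | n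
    · by_cases hn : (2 : ℤ) = n
      · subst hn
        -- The L_3 coefficient of the link gives the factor 2.
        simp only [adCoeff] at hL
        norm_num at hL
        simp [vL]
        linear_combination -hL
      · exact repr_eq_zero_of_vL_lie_eq_zero (by rw [lie_sub, lie_smul, hB, hself]; simp)
          (adCoeff_L_ne_zero ε hn)
    · have hB0 : (basis ε).repr B (Label.Y n) = 0 := by
        by_cases hn : adCoeff ε 2 (Label.Y n) = 0
        · have hA0 : (basis ε).repr A (Label.Y (n - 1)) = 0 := by
            refine repr_eq_zero_of_vL_lie_eq_zero hA fun h => ?_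
            simp only [adCoeff] at hn h
            push_cast at hn h
            exact absurd (show (1 : ℂ) = 0 by linear_combination 2 * h - 2 * hn) one_ne_zero
          have hn1 : adCoeff ε 1 (Label.Y n) ≠ 0 :=
            (adCoeff_one_Y_ne_zero_or ε n).resolve_right (not_not.mpr hn)
          simpa [hA0, hn1] using hY (n - 1)
        · exact repr_eq_zero_of_vL_lie_eq_zero hB hn
      simp [vL, hB0]
    · exact repr_eq_zero_of_vL_lie_eq_zero (m := 2) (by rw [lie_sub, lie_smul, hB, hself]; simp)
        (adCoeff_M_ne_zero ε 2 fun hn => ha (by rw [hn]))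

/-- Perfectness in uniform form: either bracket alone can vanish for some n, but their difference is
2, 3/2 or 1 times the basis vector, independently of n. -/
theorem exists_smul_basis_eq (ε : Eps) (a : Label) : ∃ (t : ℂ) (b : Label),
    basis ε a = t • (⁅vL ε 1, basis ε b⁆ - ⁅vL ε 0, basis ε a⁆) := by
  rcases a with n | n | n
  · refine ⟨1 / 2, Label.L (n - 1), ?_⟩
    simp only [vL_lie_basis, Label.shift, adCoeff, add_sub_cancel, zero_add]
    push_cast
    module
  · refine ⟨2 / 3, Label.Y (n - 1), ?_⟩
    simp only [vL_lie_basis, Label.shift, adCoeff, add_sub_cancel, zero_add]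
    push_cast
    module
  · refine ⟨1, Label.M (n - 1), ?_⟩
    simp only [vL_lie_basis, Label.shift, adCoeff, add_sub_cancel, zero_add]
    push_cast
    module

theorem eq_zero_of_lie_apply_eq_zero {ε : Eps} {f : SV ε →ₗ[ℂ] SV ε →ₗ[ℂ] SV ε}
    (hf : IsBiderivation f) (h : ∀ x y z : SV ε, ⁅f x y, z⁆ = 0) : f = 0 := by
  have h0 (x y z : SV ε) : f ⁅x, y⁆ z = 0 := by
    rw [hf.lie_left, h, ← lie_skew, h]
    simp
  refine (basis ε).ext fun a => LinearMap.ext fun z => ?_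
  obtain ⟨t, b, hb⟩ := exists_smul_basis_eq ε a
  rw [hb]
  simp [h0]

end SchrodingerVirasoro

open SchrodingerVirasoro in
theorem corollary3p6 (ε : SchrodingerVirasoro.Eps) (f : SV ε →ₗ[ℂ] SV ε →ₗ[ℂ] SV ε)
    (hf : IsBiderivation f) (hskew : IsSkewSymmetricMap f) : IsInnerBiderivation f := by
  have h01 : ⁅vL ε 0, vL ε 1⁆ = -vL ε 1 := by
    simpa [adCoeff, Label.shift, vL] using vL_lie_basis ε 0 (Label.L 1)
  have h02 : ⁅vL ε 0, vL ε 2⁆ = -((2 : ℂ) • vL ε 2) := by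
    simpa [adCoeff, Label.shift, vL] using vL_lie_basis ε 0 (Label.L 2)
  have cancel {s t : SV ε} (h : ⁅s, t⁆ = ⁅t, s⁆) : ⁅s, t⁆ = 0 :=
    eq_zero_of_eq_neg ε _ (by rw [lie_skew]; exact h)
  have h11 := hf.lie_apply_lie hskew (vL ε 0) (vL ε 1) (vL ε 0) (vL ε 1)
  have h22 := hf.lie_apply_lie hskew (vL ε 0) (vL ε 2) (vL ε 0) (vL ε 2)
  have h12 := hf.lie_apply_lie hskew (vL ε 0) (vL ε 1) (vL ε 0) (vL ε 2)
  have hA := cancel h11.symm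
  have hB := cancel h22.symm
  rw [h01, neg_lie, neg_eq_zero] at hA
  rw [h02, neg_lie, smul_lie, neg_eq_zero, smul_eq_zero_iff_right two_ne_zero] at hB
  rw [h01, h02, lie_neg, lie_smul, neg_lie, neg_inj, ← lie_skew] at h12
  obtain ⟨c, hc1, hc2⟩ := exists_smul_vL hA hB (by rw [← h12]; module)
  -- The sign comes from [L_0,L_1] = -L_1.
  let g := f - (-c) • (LieModule.toEnd ℂ (SV ε) (SV ε) : SV ε →ₗ[ℂ] SV ε →ₗ[ℂ] SV ε)
  have hg : IsBiderivation g := hf.sub_smul_bracket _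
  have hgs : IsSkewSymmetricMap g := hskew.sub_smul_bracket _
  have hgap (x y : SV ε) : g x y = f x y - (-c) • ⁅x, y⁆ := rfl
  have hg1 : g (vL ε 0) (vL ε 1) = f (vL ε 0) (vL ε 1) - c • vL ε 1 := by
    rw [hgap, h01]; module
  have hg2 : g (vL ε 0) (vL ε 2) = f (vL ε 0) (vL ε 2) - (2 * c) • vL ε 2 := by
    rw [hgap, h02]; module
  have hcentral (x y z : SV ε) : ⁅g x y, z⁆ = 0 := by
    have e1 := hg.lie_apply_lie hgs (vL ε 0) (vL ε 1) x y
    have e2 := hg.lie_apply_lie hgs (vL ε 0) (vL ε 2) x y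
    rw [hg1, hc1, h01, neg_lie, eq_comm, neg_eq_zero] at e1
    rw [hg2, hc2, h02, neg_lie, smul_lie, eq_comm, neg_eq_zero,
      smul_eq_zero_iff_right two_ne_zero] at e2
    exact lie_eq_zero_of_vL_lie_eq_zero e1 e2 z
  have hg0 := eq_zero_of_lie_apply_eq_zero hg hcentral
  exact ⟨-c, fun x y => sub_eq_zero.mp ((hgap x y).symm.trans (by rw [hg0]; rfl))⟩
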